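/- For a word $w=a_0a_1\cdots a_{n^2-1}$ of length $n^2$ ($n\ge 1$), arrange the letters of $w$ in row-major order in an $n\times n$ array and let $\mathrm{diag}(w)=a_0a_{n+1}a_{2n+2}\cdots a_{n^2-1}$ be the word on its main diagonal. For a language $L$ put $\mathrm{diag}(L)=\{\mathrm{diag}(w) : w\in L \text{ and } |w|=n^2 \text{ for some } n\ge 1\}$. Theorem. There exists a context-free language $L$ such that $\mathrm{diag}(L)$ is not context-free. Explicitly, over the alphabet $\{a,b,c,d,e,f,g,h,i,j,0\}$ of $11$ letters, let $$L_1=\bigcup_{m\ge 3} a\,0^{3m+1}\,b\,(0^+c)^{m-2}\,0^+,\qquad L_2=\bigcup_{n\ge 3} d\,0^{3n+1}\,e\,(0^+f)^{n-2}\,0^+,\qquad L_3=\bigcup_{p\ge 3} g\,0^{3p+1}\,h\,(0^+i)^{p-2}\,0^+j.$$ Then $L_1,L_2,L_3$ and their concatenation $L=L_1L_2L_3$ are context-free, $\mathrm{diag}(L)$ is not context-free, and $$\mathrm{diag}(L)\cap a\,b\,c^+d\,e\,f^+g\,h\,i^+j=\{a\,b\,c^t\,d\,e\,f^t\,g\,h\,i^t\,j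 : t\ge 1\},$$ which is not context-free either. -/

import Mathlib

namespace DiagLang

/-- The `n × n` array holding the letters of a word of length `n ^ 2` in row-major order:
the entry in row `i` and column `j` is the letter number `i * n + j` (counted from `0`). -/
def squareArray {α : Type*} (n : ℕ) (w : List α) (hw : w.length = n ^ 2) :
    Matrix (Fin n) (Fin n) α :=
  fun i j => w[(i : ℕ) * n + (j : ℕ)]'(by
    have h1 : ((i : ℕ) + 1) * n ≤ n * n := Nat.mul_le_mul_right n i.isLt
    have h2 := j.isLt
    rw [hw, pow_two]
    linarith)

/-- The word read along the main diagonal of the array of a word of length `n ^ 2`. -/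
def diagWord {α : Type*} (n : ℕ) (w : List α) (hw : w.length = n ^ 2) : List α :=
  List.ofFn (squareArray n w hw).diag

/-- `diag(L)`: the diagonals of those words of `L` whose length is `n ^ 2` for some `n ≥ 1`. -/
def diag {α : Type*} (L : Language α) : Language α :=
  {x | ∃ w ∈ L, ∃ n : ℕ, 1 ≤ n ∧ ∃ hw : w.length = n ^ 2, x = diagWord n w hw}

/-- The alphabet of `11` letters. -/
inductive Letter
  | a | b | c | d | e | f | g | h | i | j | zero
  deriving DecidableEq

/-- The language whose only word is the one-letter word `x`. -/
def sym (x : Letter) : Language Letter := {[x]}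

/-- The language `x⁺` of all nonempty powers of the letter `x`. -/
def plus (x : Letter) : Language Letter := {w | ∃ k : ℕ, 1 ≤ k ∧ w = List.replicate k x}

open Letter

/-- `{a 0^(3m+1) b (0⁺ c)^(m-2) 0⁺ : m ≥ 3}` -/
def L₁ : Language Letter :=
  {w | ∃ m : ℕ, 3 ≤ m ∧
    w ∈ sym a * sym zero ^ (3 * m + 1) * sym b * (plus zero * sym c) ^ (m - 2) * plus zero}

/-- `{d 0^(3n+1) e (0⁺ f)^(n-2) 0⁺ : n ≥ 3}` -/
def L₂ : Language Letter :=
  {w | ∃ n : ℕ, 3 ≤ n ∧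
    w ∈ sym d * sym zero ^ (3 * n + 1) * sym e * (plus zero * sym f) ^ (n - 2) * plus zero}

/-- `{g 0^(3p+1) h (0⁺ i)^(p-2) 0⁺ j : p ≥ 3}` -/
def L₃ : Language Letter :=
  {w | ∃ p : ℕ, 3 ≤ p ∧
    w ∈ sym g * sym zero ^ (3 * p + 1) * sym h * (plus zero * sym i) ^ (p - 2) * plus zero *
      sym j}

/-- The regular language `a b c⁺ d e f⁺ g h i⁺ j`. -/
def pattern : Language Letter :=
  sym a * sym b * plus c * sym d * sym e * plus f * sym g * sym h * plus i * sym j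

/-- `{a b c^t d e f^t g h i^t j : t ≥ 1}` -/
def target : Language Letter :=
  {w | ∃ t : ℕ, 1 ≤ t ∧
    w = [a, b] ++ List.replicate t c ++ [d, e] ++ List.replicate t f ++ [g, h] ++
      List.replicate t i ++ [j]}

end DiagLang

/-! The diagonal of an N × N array occupies the positions k(N+1) of the word. In a word of `L₁ * L₂
* L₃` the markers a, b, d, e, g, h, j occur once each. If the diagonal fits `pattern`, the
neighbours a and b lie N+1 apart, so N = 3m+1; likewise N = 3n+1 = 3p+1, hence m = n = p. The
diagonal has r + s + q + 7 = N letters, where r, s, q are its numbers of c, f, i, so r + s + q =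
3(m-2). Each summand is at most m-2, so all three are equal. Conversely, choosing every variable run
of zeros of length N puts all nonzero letters on the diagonal (`diagWord_cons_spread`).

For non-context-freeness, `Language.IsContextFree.exists_pump` doubles two factors of a long word of
`target`. Markers cannot be doubled, so each factor is a power of one of c, f, i; the new word still
fits `pattern`, yet at most two of the three counts grow. `not_isContextFree_of_target_le` runs this
for `diag L` and `target` at once, without closure under intersection with regular languages.

Context-freeness of the blocks and of products follows by exhibiting each language as a component of
the least solution of a grammar's inequalities (`Language.isContextFree_of_least`). -/

namespace ContextFreeGrammar

/-! ### Parses and the weak pumping lemma -/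

variable {T : Type*} {g : ContextFreeGrammar T}

/-- `g.Parses S n α w`: the word `w` is derived from the string `α` by `n` rule applications,
all of them to nonterminals in `S`. -/
inductive Parses (g : ContextFreeGrammar T) (S : Set g.NT) :
    ℕ → List (Symbol T g.NT) → List T → Prop
  | nil : Parses g S 0 [] []
  | terminal (t : T) {n : ℕ} {α : List (Symbol T g.NT)} {w : List T} (h : Parses g S n α w) :
      Parses g S n (Symbol.terminal t :: α) (t :: w)
  | nonterminal {r : ContextFreeRule T g.NT} (hr : r ∈ g.rules) (hS : r.input ∈ S) {n m : ℕ}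
      {α : List (Symbol T g.NT)} {v w : List T} (hv : Parses g S n r.output v)
      (hw : Parses g S m α w) :
      Parses g S (n + m + 1) (Symbol.nonterminal r.input :: α) (v ++ w)

lemma Derives.append {α α' β β' : List (Symbol T g.NT)} (h : g.Derives α α')
    (h' : g.Derives β β') : g.Derives (α ++ β) (α' ++ β') :=
  (h.append_right β).trans (h'.append_left α')

lemma derives_output {r : ContextFreeRule T g.NT} (hr : r ∈ g.rules) :
    g.Derives [Symbol.nonterminal r.input] r.output :=
  Produces.single ⟨r, hr, ContextFreeRule.Rewrites.input_output⟩

lemma Parses.derives {S : Set g.NT} {n : ℕ} {α : List (Symbol T g.NT)} {w : List T}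
    (h : g.Parses S n α w) : g.Derives α (w.map Symbol.terminal) := by
  induction h with
  | nil => exact Derives.refl _
  | terminal t _ ih => simpa using ih.append_left [Symbol.terminal t]
  | nonterminal hr _ _ _ ihv ihw =>
    simpa using ((derives_output hr).trans ihv).append ihw

lemma Parses.append {S : Set g.NT} {n m : ℕ} {α β : List (Symbol T g.NT)} {v w : List T}
    (hv : g.Parses S n α v) (hw : g.Parses S m β w) :
    g.Parses S (n + m) (α ++ β) (v ++ w) := by
  induction hv with
  | nil => simpa using hw
  | terminal t _ ih => exact ih.terminal t
  | nonterminal hr hS hv _ _ ih =>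
    have := Parses.nonterminal hr hS hv ih
    simpa [add_assoc, add_comm, add_left_comm] using this

lemma Parses.of_append {S : Set g.NT} {α β : List (Symbol T g.NT)} {n : ℕ} {w : List T}
    (h : g.Parses S n (α ++ β) w) :
    ∃ k m u v, n = k + m ∧ w = u ++ v ∧ g.Parses S k α u ∧ g.Parses S m β v := by
  induction α generalizing n w with
  | nil => exact ⟨0, n, [], w, by simp, rfl, .nil, h⟩
  | cons s α ih =>
    cases h with
    | terminal t h =>
      obtain ⟨k, m, u, v, rfl, rfl, hu, hv⟩ := ih h
      exact ⟨k, m, t :: u, v, rfl, rfl, hu.terminal t, hv⟩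
    | nonterminal hr hS hx h =>
      obtain ⟨k, m, u, v, rfl, rfl, hu, hv⟩ := ih h
      exact ⟨_, m, _, v, by ring, by simp, .nonterminal hr hS hx hu, hv⟩

lemma parses_terminals (S : Set g.NT) (w : List T) :
    g.Parses S 0 (w.map Symbol.terminal) w := by
  induction w with
  | nil => exact .nil
  | cons t w ih => exact ih.terminal t

lemma Derives.exists_parses {α : List (Symbol T g.NT)} {w : List T}
    (h : g.Derives α (w.map Symbol.terminal)) : ∃ n, g.Parses Set.univ n α w := by
  induction h using Relation.ReflTransGen.head_induction_on with
  | refl => exact ⟨0, parses_terminals _ w⟩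
  | head h _ ih =>
    obtain ⟨r, hr, h⟩ := h
    obtain ⟨p, q, rfl, rfl⟩ := h.exists_parts
    obtain ⟨n, hn⟩ := ih
    -- One rewriting step is undone: the parse is cut around the rule's output, and the middle piece
    -- is placed under the rule's input.
    obtain ⟨_, _, _, v₂, -, rfl, h₁₂, h₃⟩ := hn.of_append
    obtain ⟨_, _, _, v₁, -, rfl, h₁, h₂⟩ := h₁₂.of_append
    have := (h₁.append (.nonterminal hr (Set.mem_univ _) h₂ .nil)).append h₃
    exact ⟨_, by simpa using this⟩

/-- The type of nonterminals may be infinite; only the finitely many left-hand sides of rules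
matter, and the length bound needs a finite set. -/
lemma Parses.mem_inputs {n : ℕ} {α : List (Symbol T g.NT)} {w : List T}
    (h : g.Parses Set.univ n α w) : g.Parses {A | ∃ r ∈ g.rules, r.input = A} n α w := by
  induction h with
  | nil => exact .nil
  | terminal t _ ih => exact ih.terminal t
  | nonterminal hr _ _ _ ihv ihw =>
    exact .nonterminal hr (Set.mem_ofPred.mpr ⟨_, hr, rfl⟩) ihv ihw

/-- Either a parse does not use the nonterminal `A`, or it contains a parse from `A`. -/
lemma Parses.avoid_or_exists {S : Set g.NT} {n : ℕ} {α : List (Symbol T g.NT)} {w : List T}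
    (h : g.Parses S n α w) (A : g.NT) :
    g.Parses (S \ {A}) n α w ∨ ∃ m ≤ n, ∃ u x z, w = u ++ x ++ z ∧
      g.Parses S m [Symbol.nonterminal A] x ∧
      g.Derives α (u.map Symbol.terminal ++ [Symbol.nonterminal A] ++ z.map Symbol.terminal) := by
  induction h with
  | nil => exact .inl .nil
  | terminal t _ ih =>
    rcases ih with h | ⟨m, hm, u, x, z, rfl, hx, hd⟩
    · exact .inl (h.terminal t)
    · exact .inr ⟨m, hm, t :: u, x, z, rfl, hx, by simpa using hd.append_left [.terminal t]⟩
  | @nonterminal r hr hS n m α v w hv hw ihv ihw =>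
    by_cases hA : r.input = A
    · subst hA
      refine .inr ⟨n + 1, by omega, [], v, w, by simp, ?_, ?_⟩
      · simpa using Parses.nonterminal hr hS hv .nil
      · simpa using hw.derives.append_left [.nonterminal r.input]
    · rcases ihv with hv' | ⟨k, hk, u, x, z, rfl, hx, hd⟩
      · rcases ihw with hw' | ⟨k, hk, u, x, z, rfl, hx, hd⟩
        · exact .inl (.nonterminal hr (Set.mem_sdiff_singleton.mpr ⟨hS, hA⟩) hv' hw')
        · refine .inr ⟨k, by omega, v ++ u, x, z, by simp, hx, ?_⟩
          simpa using ((derives_output hr).trans hv.derives).append hd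
      · refine .inr ⟨k, by omega, u, x, z ++ w, by simp, hx, ?_⟩
        simpa using ((derives_output hr).trans hd).append hw.derives

/-- Some derivation of `w` from `α` contains a loop `B ⇒ v B y` with `v y` nonempty. -/
def Pumpable (g : ContextFreeGrammar T) (α : List (Symbol T g.NT)) (w : List T) : Prop :=
  ∃ B u v x y z, w = u ++ v ++ x ++ y ++ z ∧ v ++ y ≠ [] ∧
    g.Derives α (u.map Symbol.terminal ++ [Symbol.nonterminal B] ++ z.map Symbol.terminal) ∧
    g.Derives [Symbol.nonterminal B]
      (v.map Symbol.terminal ++ [Symbol.nonterminal B] ++ y.map Symbol.terminal) ∧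
    g.Derives [Symbol.nonterminal B] (x.map Symbol.terminal)

lemma Pumpable.append_right {α β : List (Symbol T g.NT)} {v w : List T} (h : g.Pumpable α v)
    (hw : g.Derives β (w.map Symbol.terminal)) : g.Pumpable (α ++ β) (v ++ w) := by
  obtain ⟨B, u, v, x, y, z, rfl, hne, h₁, h₂, h₃⟩ := h
  exact ⟨B, u, v, x, y, z ++ w, by simp, hne, by simpa using h₁.append hw, h₂, h₃⟩

lemma Pumpable.append_left {α β : List (Symbol T g.NT)} {v w : List T} (h : g.Pumpable β w)
    (hv : g.Derives α (v.map Symbol.terminal)) : g.Pumpable (α ++ β) (v ++ w) := by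
  obtain ⟨B, u, v', x, y, z, rfl, hne, h₁, h₂, h₃⟩ := h
  exact ⟨B, v ++ u, v', x, y, z, by simp, hne, by simpa using hv.append h₁, h₂, h₃⟩

lemma Pumpable.of_derives {α β : List (Symbol T g.NT)} {w : List T} (h : g.Pumpable β w)
    (hα : g.Derives α β) : g.Pumpable α w := by
  obtain ⟨B, u, v, x, y, z, hw, hne, h₁, h₂, h₃⟩ := h
  exact ⟨B, u, v, x, y, z, hw, hne, hα.trans h₁, h₂, h₃⟩

/-- A loop in one symbol's part is a loop in the whole, so non-pumpability passes to each symbol and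
the bounds add up. -/
lemma Parses.length_le_mul {S : Set g.NT} {K : ℕ} (hK : 1 ≤ K)
    (hS : ∀ (A : g.NT) (n : ℕ) (w : List T), g.Parses S n [Symbol.nonterminal A] w →
      ¬ g.Pumpable [Symbol.nonterminal A] w → w.length ≤ K)
    {n : ℕ} {α : List (Symbol T g.NT)} {w : List T} (h : g.Parses S n α w)
    (hp : ¬ g.Pumpable α w) : w.length ≤ α.length * K := by
  induction h with
  | nil => simp
  | @terminal t n α w h ih =>
    have := ih fun hp' => hp <| hp'.append_left (α := [.terminal t]) (v := [t]) (Derives.refl _)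
    simp only [List.length_cons, add_mul]
    omega
  | @nonterminal r hr hA n m α v w hv hw ihv ihw =>
    have h₁ : g.Parses S (n + 1) [.nonterminal r.input] v := by
      simpa using Parses.nonterminal hr hA hv .nil
    have h₂ := hS _ _ _ h₁ fun hp' => hp <| hp'.append_right hw.derives
    have h₃ := ihw fun hp' => hp <| hp'.append_left h₁.derives
    simp only [List.length_cons, List.length_append, add_mul]
    omega

/-- Outer induction on the number of allowed nonterminals, inner induction on the size of the parse;
this replaces tree height and the choice of a minimal tree. -/
lemma Parses.length_le_pow {b : ℕ} (hb : 1 ≤ b) (hrules : ∀ r ∈ g.rules, r.output.length ≤ b)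
    (k : ℕ) : ∀ (S : Set g.NT), S.Finite → S.ncard ≤ k → ∀ (n : ℕ) (A : g.NT) (w : List T),
      g.Parses S n [Symbol.nonterminal A] w → ¬ g.Pumpable [Symbol.nonterminal A] w →
      w.length ≤ b ^ k := by
  induction k with
  | zero =>
    intro S hfin hS n A w h
    rw [Nat.le_zero, Set.ncard_eq_zero hfin] at hS
    subst hS
    cases h with
    | nonterminal _ hA => exact hA.elim
  | succ k ihk =>
    intro S hfin hS n
    induction n using Nat.strong_induction_on with
    | _ n ihn =>
      intro A w h hp
      cases h with
      | @nonterminal r hr hA n m α v w hv hw =>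
        cases hw
        rw [List.append_nil] at hp ⊢
        rcases hv.avoid_or_exists r.input with hv' | ⟨m, hm, u, x, z, rfl, hx, hd⟩
        -- The root nonterminal does not recur, so it can be removed from `S`: at most `b` symbols,
        -- each of yield at most `b ^ k`.
        · have hlt := Set.ncard_sdiff_singleton_lt_of_mem hA hfin
          refine (hv'.length_le_mul (Nat.one_le_pow _ _ hb)
            (fun A n w => ihk _ hfin.sdiff (by omega) n A w)
            (fun hp' => hp (hp'.of_derives (derives_output hr)))).trans ?_
          rw [pow_succ']
          exact Nat.mul_le_mul_right _ (hrules r hr)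
        -- The root recurs. A loop with empty sides is cut out, leaving a smaller parse of the same
        -- word; any other loop makes the word pumpable.
        · by_cases huz : u ++ z = []
          · obtain ⟨rfl, rfl⟩ := List.append_eq_nil_iff.mp huz
            rw [List.append_nil, List.nil_append] at hp ⊢
            exact ihn m (by omega) _ _ hx hp
          · refine (hp ⟨r.input, [], u, x, z, [], by simp, huz, by simpa using Derives.refl _,
              (derives_output hr).trans hd, hx.derives⟩).elim

end ContextFreeGrammar

/-- A weak form of the pumping lemma: every long word `u v x y z` of a context-free language
has a nonempty pair of factors `v`, `y` that can be doubled. -/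
theorem Language.IsContextFree.exists_pump {T : Type*} {L : Language T} (hL : L.IsContextFree) :
    ∃ p : ℕ, ∀ w ∈ L, p < w.length → ∃ u v x y z : List T,
      w = u ++ v ++ x ++ y ++ z ∧ v ++ y ≠ [] ∧ u ++ v ++ v ++ x ++ y ++ y ++ z ∈ L := by
  classical
  obtain ⟨g, rfl⟩ := hL
  let S : Set g.NT := {A | ∃ r ∈ g.rules, r.input = A}
  have hfin : S.Finite := (g.rules.finite_toSet.image ContextFreeRule.input).subset
    fun A ⟨r, hr, h⟩ => ⟨r, hr, h⟩
  let b := g.rules.sup (fun r => r.output.length) + 1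
  have hrules : ∀ r ∈ g.rules, r.output.length ≤ b := fun r hr =>
    (Finset.le_sup (f := fun r : ContextFreeRule T g.NT => r.output.length) hr).trans
      (Nat.le_succ _)
  refine ⟨b ^ S.ncard, fun w hw hlen => ?_⟩
  obtain ⟨n, hn⟩ := ContextFreeGrammar.Derives.exists_parses hw
  have hp : g.Pumpable [Symbol.nonterminal g.initial] w := by
    by_contra hp
    exact hlen.not_ge (ContextFreeGrammar.Parses.length_le_pow (Nat.le_add_left 1 _) hrules _ S
      hfin le_rfl n _ w hn.mem_inputs hp)
  obtain ⟨B, u, v, x, y, z, rfl, hne, h₁, h₂, h₃⟩ := hp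
  refine ⟨u, v, x, y, z, rfl, hne, ?_⟩
  have h₄ := (h₂.append_left (v.map Symbol.terminal)).append_right (y.map Symbol.terminal)
  have h₅ := (h₃.append_left ((v ++ v).map Symbol.terminal)).append_right
    ((y ++ y).map Symbol.terminal)
  have h₆ := h₂.trans (by simpa using h₄.trans (by simpa using h₅))
  have h₇ := (h₆.append_left (u.map Symbol.terminal)).append_right (z.map Symbol.terminal)
  rw [ContextFreeGrammar.mem_language_iff]
  exact h₁.trans (by simpa using h₇)

/-! ### Grammars as systems of language inequalities; products -/

namespace ContextFreeGrammar

variable {T : Type*} {g : ContextFreeGrammar T}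

/-- The words derived from the nonterminal `A`. -/
def languageFrom (g : ContextFreeGrammar T) (A : g.NT) : Language T :=
  {w | g.Derives [Symbol.nonterminal A] (w.map Symbol.terminal)}

/-- The language of a symbol, given the languages of the nonterminals. -/
def symbolLanguage {N : Type*} (I : N → Language T) : Symbol T N → Language T
  | .terminal t => {[t]}
  | .nonterminal A => I A

/-- The language of a string of symbols, given the languages of the nonterminals. -/
def stringLanguage {N : Type*} (I : N → Language T) (α : List (Symbol T N)) : Language T :=
  (α.map (symbolLanguage I)).prod

lemma Parses.mem_stringLanguage {I : g.NT → Language T}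
    (hI : ∀ r ∈ g.rules, stringLanguage I r.output ≤ I r.input) {S : Set g.NT} {n : ℕ}
    {α : List (Symbol T g.NT)} {w : List T} (h : g.Parses S n α w) :
    w ∈ stringLanguage I α := by
  induction h with
  | nil => exact Language.nil_mem_one
  | terminal t _ ih => exact Language.append_mem_mul (a := [t]) (Set.mem_singleton _) ih
  | nonterminal hr _ _ _ ihv ihw => exact Language.append_mem_mul (hI _ hr ihv) ihw

/-- The languages derived from the nonterminals are below any solution of the inequalities
given by the rules. -/
lemma languageFrom_le {I : g.NT → Language T}
    (hI : ∀ r ∈ g.rules, stringLanguage I r.output ≤ I r.input) (A : g.NT) :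
    g.languageFrom A ≤ I A := by
  intro w hw
  obtain ⟨n, hn⟩ := Derives.exists_parses hw
  have h := hn.mem_stringLanguage hI
  rwa [stringLanguage, List.map_singleton, List.prod_singleton] at h

lemma derives_of_mem_stringLanguage {α : List (Symbol T g.NT)} {w : List T}
    (hw : w ∈ stringLanguage g.languageFrom α) : g.Derives α (w.map Symbol.terminal) := by
  induction α generalizing w with
  | nil =>
    obtain rfl := (Language.mem_one w).mp hw
    exact Derives.refl _
  | cons s α ih =>
    obtain ⟨u, hu, v, hv, rfl⟩ := Language.mem_mul.mp hw
    rw [List.map_append]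
    refine Derives.append (α := [s]) ?_ (ih hv)
    cases s with
    | terminal t =>
      obtain rfl := Set.mem_singleton_iff.mp hu
      exact Derives.refl _
    | nonterminal A => exact hu

/-- The languages derived from the nonterminals solve the inequalities given by the rules. -/
lemma stringLanguage_le_languageFrom {r : ContextFreeRule T g.NT} (hr : r ∈ g.rules) :
    stringLanguage g.languageFrom r.output ≤ g.languageFrom r.input :=
  fun _ hw => (derives_output hr).trans (derives_of_mem_stringLanguage hw)

/-- Renaming of the nonterminals of a rule. -/
def mapRule {N M : Type*} (φ : N → M) (r : ContextFreeRule T N) : ContextFreeRule T M :=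
  ⟨φ r.input, r.output.map fun
    | .terminal t => .terminal t
    | .nonterminal A => .nonterminal (φ A)⟩

lemma stringLanguage_mapRule {N M : Type*} (φ : N → M) (I : M → Language T)
    (r : ContextFreeRule T N) :
    stringLanguage I (mapRule φ r).output = stringLanguage (I ∘ φ) r.output := by
  simp only [stringLanguage, mapRule, List.map_map]
  congr 2
  funext s
  cases s <;> rfl

end ContextFreeGrammar

open ContextFreeGrammar in
/-- The components of the least solution of the inequalities given by finitely many rules are
context-free. -/
theorem Language.isContextFree_of_least {T : Type*} {N : Type}
    (rules : Finset (ContextFreeRule T N)) (A : N) (I : N → Language T)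
    (hI : ∀ r ∈ rules, stringLanguage I r.output ≤ I r.input)
    (hmin : ∀ J : N → Language T, (∀ r ∈ rules, stringLanguage J r.output ≤ J r.input) →
      I A ≤ J A) : (I A).IsContextFree :=
  ⟨⟨N, A, rules⟩, le_antisymm (languageFrom_le (g := ⟨N, A, rules⟩) hI A)
    (hmin (languageFrom ⟨N, A, rules⟩) fun _ hr =>
      stringLanguage_le_languageFrom (g := ⟨N, A, rules⟩) hr)⟩

-- The nonterminals are the disjoint union of both sets with a fresh start `none`, whose only rule
-- produces the two old start symbols in order.
open ContextFreeGrammar in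
protected theorem Language.IsContextFree.mul {T : Type*} {L M : Language T}
    (hL : L.IsContextFree) (hM : M.IsContextFree) : (L * M).IsContextFree := by
  classical
  obtain ⟨g₁, rfl⟩ := hL
  obtain ⟨g₂, rfl⟩ := hM
  let φ₁ : g₁.NT → Option (g₁.NT ⊕ g₂.NT) := fun A => some (.inl A)
  let φ₂ : g₂.NT → Option (g₁.NT ⊕ g₂.NT) := fun A => some (.inr A)
  let I : Option (g₁.NT ⊕ g₂.NT) → Language T
    | none => g₁.language * g₂.language
    | some (.inl A) => g₁.languageFrom A
    | some (.inr A) => g₂.languageFrom A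
  let r₀ : ContextFreeRule T (Option (g₁.NT ⊕ g₂.NT)) :=
    ⟨none, [.nonterminal (φ₁ g₁.initial), .nonterminal (φ₂ g₂.initial)]⟩
  refine Language.isContextFree_of_least
    (insert r₀ (g₁.rules.image (mapRule φ₁) ∪ g₂.rules.image (mapRule φ₂))) none I ?_ ?_
  · intro r hr
    simp only [Finset.mem_insert, Finset.mem_union, Finset.mem_image] at hr
    rcases hr with rfl | ⟨r, hr, rfl⟩ | ⟨r, hr, rfl⟩
    · simp only [r₀, stringLanguage, symbolLanguage, List.map_cons, List.map_nil, List.prod_cons,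
        List.prod_nil, mul_one]
      exact le_rfl
    · rw [stringLanguage_mapRule]
      exact stringLanguage_le_languageFrom hr
    · rw [stringLanguage_mapRule]
      exact stringLanguage_le_languageFrom hr
  · intro J hJ
    simp only [Finset.mem_insert, Finset.mem_union, Finset.mem_image] at hJ
    have h₁ : g₁.language ≤ J (φ₁ g₁.initial) :=
      languageFrom_le (I := J ∘ φ₁) (fun r hr => stringLanguage_mapRule φ₁ J r ▸
        hJ _ (.inr (.inl ⟨r, hr, rfl⟩))) _
    have h₂ : g₂.language ≤ J (φ₂ g₂.initial) :=
      languageFrom_le (I := J ∘ φ₂) (fun r hr => stringLanguage_mapRule φ₂ J r ▸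
        hJ _ (.inr (.inr ⟨r, hr, rfl⟩))) _
    have h := hJ r₀ (.inl rfl)
    simp only [r₀, stringLanguage, symbolLanguage, List.map_cons, List.map_nil, List.prod_cons,
      List.prod_nil, mul_one] at h
    exact (mul_le_mul' h₁ h₂).trans h

/-! ### Context-freeness of `L₁`, `L₂`, `L₃` -/

namespace DiagLang

open Letter ContextFreeGrammar

/-- The common shape of `L₁`, `L₂` and, up to a final letter, `L₃`. -/
def block (x y z : Letter) : Language Letter :=
  {w | ∃ m : ℕ, 3 ≤ m ∧
    w ∈ sym x * sym zero ^ (3 * m + 1) * sym y * (plus zero * sym z) ^ (m - 2) * plus zero}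

/-- The nonterminals of a grammar for `block x y z`. -/
inductive BlockNT
  | start | nest | zeros
  deriving DecidableEq

/-- The rules of a grammar for `block x y z`. -/
def blockRules (x y z : Letter) : Finset (ContextFreeRule Letter BlockNT) :=
  {⟨.start, .terminal x :: (List.replicate 7 (.terminal zero) ++
      [.nonterminal .nest, .nonterminal .zeros])⟩,
    ⟨.nest, List.replicate 3 (.terminal zero) ++
      [.nonterminal .nest, .nonterminal .zeros, .terminal z]⟩,
    ⟨.nest, List.replicate 3 (.terminal zero) ++
      [.terminal y, .nonterminal .zeros, .terminal z]⟩,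
    ⟨.zeros, [.terminal zero, .nonterminal .zeros]⟩,
    ⟨.zeros, [.terminal zero]⟩}

lemma sym_mul_plus_le (x : Letter) : sym x * plus x ≤ plus x := by
  rintro _ ⟨u, rfl, _, ⟨k, -, rfl⟩, rfl⟩
  exact ⟨k + 1, by omega, rfl⟩

lemma sym_le_plus (x : Letter) : sym x ≤ plus x := by
  rintro _ rfl
  exact ⟨1, le_rfl, rfl⟩

lemma plus_le {x : Letter} {L : Language Letter} (h₁ : sym x ≤ L) (h₂ : sym x * L ≤ L) :
    plus x ≤ L := by
  rintro _ ⟨k, hk, rfl⟩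
  induction k, hk using Nat.le_induction with
  | base => exact h₁ rfl
  | succ k _ ih => exact h₂ (Language.append_mem_mul (a := [x]) rfl ih)

/-- With t = m - 3, 3m + 1 = 7 + 3(m - 2): seven fixed zeros, then three for each factor 0⁺z. The
part after the seven zeros and before the last 0⁺ is nested, which explains the rules of
`blockRules`. -/
lemma block_eq (x y z : Letter) : block x y z = ⨆ t : ℕ, sym x * sym zero ^ 7 *
    (sym zero ^ (3 * (t + 1)) * sym y * (plus zero * sym z) ^ (t + 1)) * plus zero := by
  ext w
  rw [Language.mem_iSup]
  constructor
  · rintro ⟨m, hm, hw⟩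
    refine ⟨m - 3, ?_⟩
    have h₁ : 3 * m + 1 = 7 + 3 * (m - 3 + 1) := by omega
    have h₂ : m - 2 = m - 3 + 1 := by omega
    rw [h₁, h₂, pow_add] at hw
    simpa only [mul_assoc] using hw
  · rintro ⟨t, hw⟩
    refine ⟨t + 3, by omega, ?_⟩
    have h₁ : 3 * (t + 3) + 1 = 7 + 3 * (t + 1) := by omega
    have h₂ : t + 3 - 2 = t + 1 := by omega
    rw [h₁, h₂, pow_add]
    simpa only [mul_assoc] using hw

lemma stringLanguage_replicate {N : Type*} (I : N → Language Letter) (k : ℕ) (x : Letter)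
    (α : List (Symbol Letter N)) :
    stringLanguage I (List.replicate k (.terminal x) ++ α) = sym x ^ k * stringLanguage I α := by
  simp [stringLanguage, symbolLanguage, sym]

lemma stringLanguage_terminal {N : Type*} (I : N → Language Letter) (x : Letter)
    (α : List (Symbol Letter N)) :
    stringLanguage I (.terminal x :: α) = sym x * stringLanguage I α := rfl

lemma stringLanguage_nonterminal {N : Type*} (I : N → Language Letter) (A : N)
    (α : List (Symbol Letter N)) :
    stringLanguage I (.nonterminal A :: α) = I A * stringLanguage I α := rfl

lemma stringLanguage_nil {N : Type*} (I : N → Language Letter) :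
    stringLanguage I [] = 1 := rfl

lemma nest_step (y z : Letter) (t : ℕ) :
    sym zero ^ 3 * (sym zero ^ (3 * (t + 1)) * sym y * (plus zero * sym z) ^ (t + 1) *
      (plus zero * sym z)) =
    sym zero ^ (3 * (t + 1 + 1)) * sym y * (plus zero * sym z) ^ (t + 1 + 1) := by
  rw [pow_succ _ (t + 1), show 3 * (t + 1 + 1) = 3 + 3 * (t + 1) by ring, pow_add _ 3]
  simp only [mul_assoc]

lemma isContextFree_block (x y z : Letter) : (block x y z).IsContextFree := by
  let I : BlockNT → Language Letter
    | .start => block x y z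
    | .nest => ⨆ t : ℕ, sym zero ^ (3 * (t + 1)) * sym y * (plus zero * sym z) ^ (t + 1)
    | .zeros => plus zero
  refine Language.isContextFree_of_least (blockRules x y z) .start I ?_ ?_
  · intro r hr
    simp only [blockRules, Finset.mem_insert, Finset.mem_singleton] at hr
    rcases hr with rfl | rfl | rfl | rfl | rfl <;>
      simp only [stringLanguage_terminal, stringLanguage_nonterminal, stringLanguage_replicate,
        stringLanguage_nil, mul_one, I]
    · rw [block_eq]
      simp only [Language.mul_iSup, Language.iSup_mul, mul_assoc]
      exact le_rfl
    · simp only [Language.mul_iSup, Language.iSup_mul]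
      refine iSup_le fun t => le_iSup_of_le (t + 1) ?_
      rw [nest_step]
    · refine le_iSup_of_le 0 ?_
      simp only [zero_add, mul_one, pow_one, mul_assoc]
      exact le_rfl
    · exact sym_mul_plus_le zero
    · exact sym_le_plus zero
  · intro J hJ
    simp only [blockRules, Finset.mem_insert, Finset.mem_singleton, forall_eq_or_imp,
      forall_eq, stringLanguage_terminal, stringLanguage_nonterminal, stringLanguage_replicate,
      stringLanguage_nil, mul_one] at hJ
    obtain ⟨h₁, h₂, h₃, h₄, h₅⟩ := hJ
    have hzeros := plus_le h₅ h₄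
    have hnest : ∀ t : ℕ, sym zero ^ (3 * (t + 1)) * sym y * (plus zero * sym z) ^ (t + 1) ≤
        J .nest := by
      intro t
      induction t with
      | zero =>
        refine le_trans ?_ h₃
        simp only [zero_add, mul_one, pow_one, mul_assoc]
        gcongr
      | succ t ih =>
        refine le_trans ?_ h₂
        rw [← nest_step]
        gcongr
    change block x y z ≤ _
    rw [block_eq]
    refine iSup_le fun t => le_trans ?_ h₁
    rw [mul_assoc, mul_assoc]
    gcongr
    exact hnest t

lemma isContextFree_sym (x : Letter) : (sym x).IsContextFree := by
  refine Language.isContextFree_of_least {⟨(), [.terminal x]⟩} () (fun _ => sym x) ?_ ?_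
  · intro r hr
    obtain rfl := Finset.mem_singleton.mp hr
    simp only [stringLanguage_terminal, stringLanguage_nil, mul_one]
    exact le_rfl
  · intro J hJ
    simpa only [stringLanguage_terminal, stringLanguage_nil, mul_one] using
      hJ _ (Finset.mem_singleton_self _)

lemma L₃_eq : L₃ = block g h i * sym j := by
  ext w
  constructor
  · rintro ⟨m, hm, hw⟩
    obtain ⟨u, hu, v, hv, rfl⟩ := Language.mem_mul.mp hw
    exact Language.append_mem_mul ⟨m, hm, hu⟩ hv
  · intro hw
    obtain ⟨u, ⟨m, hm, hu⟩, v, hv, rfl⟩ := Language.mem_mul.mp hw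
    exact ⟨m, hm, Language.append_mem_mul hu hv⟩

lemma isContextFree_L₁ : L₁.IsContextFree := isContextFree_block a b c

lemma isContextFree_L₂ : L₂.IsContextFree := isContextFree_block d e f

lemma isContextFree_L₃ : L₃.IsContextFree :=
  L₃_eq ▸ (isContextFree_block g h i).mul (isContextFree_sym j)

/-! ### Diagonals of words -/

lemma length_diagWord {α : Type*} (n : ℕ) (w : List α) (hw : w.length = n ^ 2) :
    (diagWord n w hw).length = n := by
  simp [diagWord]

lemma mul_succ_lt_sq {n k : ℕ} (hk : k < n) : k * (n + 1) < n ^ 2 := by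
  nlinarith

lemma getElem?_diagWord {α : Type*} {n : ℕ} {w : List α} (hw : w.length = n ^ 2) {k : ℕ}
    (hk : k < n) : (diagWord n w hw)[k]? = w[k * (n + 1)]? := by
  have h := mul_succ_lt_sq hk
  rw [List.getElem?_eq_getElem (by simpa [diagWord] using hk),
    List.getElem?_eq_getElem (by rwa [hw])]
  simp only [diagWord, List.getElem_ofFn, Matrix.diag, squareArray, mul_add, mul_one]

lemma getElem?_of_getElem?_diagWord {α : Type*} {n : ℕ} {w : List α} (hw : w.length = n ^ 2)
    {k : ℕ} {x : α} (h : (diagWord n w hw)[k]? = some x) : w[k * (n + 1)]? = some x := by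
  obtain ⟨hk, -⟩ := List.getElem?_eq_some_iff.mp h
  rwa [← getElem?_diagWord hw (by rwa [length_diagWord] at hk)]

/-- The positions k(n+1) increase with k. This bounds letter counts on the diagonal by those in the
word. -/
lemma diagWord_sublist {α : Type*} (n : ℕ) (w : List α) (hw : w.length = n ^ 2) :
    (diagWord n w hw).Sublist w := by
  rw [List.sublist_iff_exists_fin_orderEmbedding_get_eq]
  have hlt : ∀ k : Fin (diagWord n w hw).length, (k : ℕ) * (n + 1) < w.length := fun k => by
    rw [hw]
    exact mul_succ_lt_sq (by simpa only [length_diagWord] using k.isLt)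
  refine ⟨OrderEmbedding.ofStrictMono (fun k => ⟨k * (n + 1), hlt k⟩) fun k l hkl => ?_,
    fun k => ?_⟩
  · exact Nat.mul_lt_mul_of_pos_right hkl n.succ_pos
  · simp only [List.get_eq_getElem]
    have h := getElem?_of_getElem?_diagWord hw (List.getElem?_eq_getElem k.isLt)
    exact ((List.getElem_eq_iff (hlt k)).mpr h).symm

lemma eq_of_getElem?_of_count_le_one {α : Type*} [DecidableEq α] {w : List α} {x : α}
    (h : w.count x ≤ 1) {k l : ℕ} (hk : w[k]? = some x) (hl : w[l]? = some x) : k = l := by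
  wlog hkl : k ≤ l generalizing k l
  · exact (this hl hk (by omega)).symm
  by_contra hne
  obtain ⟨hk', hk⟩ := List.getElem?_eq_some_iff.mp hk
  obtain ⟨hl', hl⟩ := List.getElem?_eq_some_iff.mp hl
  have := List.duplicate_iff_two_le_count.mp (List.duplicate_iff_exists_distinct_get.mpr
    ⟨⟨k, hk'⟩, ⟨l, hl'⟩, by simpa using lt_of_le_of_ne hkl hne, hk.symm, hl.symm⟩)
  omega

/-- Two letters that occur only once and are neighbours on the diagonal are `n` letters apart. -/
lemma eq_of_diagWord_neighbours {α : Type*} [DecidableEq α] {n : ℕ} {w : List α}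
    (hw : w.length = n ^ 2) {x y : α} (hx : w.count x ≤ 1) (hy : w.count y ≤ 1)
    {P Q R : List α} (h : w = P ++ x :: (Q ++ y :: R)) {D E : List α}
    (hD : diagWord n w hw = D ++ x :: y :: E) : n = Q.length := by
  have h₁ : w[P.length]? = some x := by simp [h]
  have h₂ : w[P.length + 1 + Q.length]? = some y := by
    rw [h, List.getElem?_append_right (by omega), show P.length + 1 + Q.length - P.length =
      Q.length + 1 by omega, List.getElem?_cons_succ, List.getElem?_append_right le_rfl]
    simp
  have h₃ := eq_of_getElem?_of_count_le_one hx h₁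
    (getElem?_of_getElem?_diagWord hw (k := D.length) (by simp [hD]))
  have h₄ := eq_of_getElem?_of_count_le_one hy h₂
    (getElem?_of_getElem?_diagWord hw (k := D.length + 1) (by simp [hD]))
  rw [add_mul] at h₄
  omega

/-- Each letter of `w` preceded by `n` zeros. -/
def spread (n : ℕ) (w : List Letter) : List Letter :=
  w.flatMap fun x => List.replicate n zero ++ [x]

lemma spread_cons (n : ℕ) (x : Letter) (w : List Letter) :
    spread n (x :: w) = List.replicate n zero ++ [x] ++ spread n w := by
  simp [spread]

lemma length_spread (n : ℕ) (w : List Letter) : (spread n w).length = w.length * (n + 1) := by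
  simp [spread, List.length_flatMap]

lemma getElem?_spread (n : ℕ) (w : List Letter) (k : ℕ) :
    (spread n w)[k * (n + 1) + n]? = w[k]? := by
  induction w generalizing k with
  | nil => simp [spread]
  | cons x w ih =>
    rw [spread_cons]
    cases k with
    | zero => simp
    | succ k =>
      rw [List.getElem?_append_right (by simp [add_mul]), List.getElem?_cons_succ, ← ih]
      congr 1
      simp [add_mul]
      omega

/-- The identity behind it is 1 + (n-1)(n+1) = n²; the first letter has no zeros before it. -/
lemma length_cons_spread {n : ℕ} (x : Letter) {w : List Letter} (hn : w.length + 1 = n) :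
    (x :: spread n w).length = n ^ 2 := by
  subst hn
  rw [List.length_cons, length_spread]
  ring

lemma diagWord_cons_spread {n : ℕ} (x : Letter) {w : List Letter} (hn : w.length + 1 = n) :
    diagWord n (x :: spread n w) (length_cons_spread x hn) = x :: w := by
  apply List.ext_getElem?
  intro k
  by_cases hk : k < n
  · rw [getElem?_diagWord _ hk]
    cases k with
    | zero => simp
    | succ k =>
      rw [show (k + 1) * (n + 1) = k * (n + 1) + n + 1 by ring, List.getElem?_cons_succ,
        getElem?_spread, List.getElem?_cons_succ]
  · rw [List.getElem?_eq_none (by rw [length_diagWord]; omega),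
      List.getElem?_eq_none (by rw [List.length_cons]; omega)]

/-! ### The words of the languages -/

lemma mem_sym_pow {x : Letter} {k : ℕ} {w : List Letter} :
    w ∈ sym x ^ k ↔ w = List.replicate k x := by
  induction k generalizing w with
  | zero => exact Language.mem_one w
  | succ k ih =>
    rw [pow_succ', Language.mem_mul, List.replicate_succ]
    constructor
    · rintro ⟨_, rfl, v, hv, rfl⟩
      rw [ih.mp hv]
      rfl
    · rintro rfl
      exact ⟨[x], rfl, _, ih.mpr rfl, rfl⟩

lemma count_of_mem_plus_zero {w : List Letter} (hw : w ∈ plus zero) {l : Letter}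
    (hl : l ≠ zero) : w.count l = 0 := by
  obtain ⟨k, -, rfl⟩ := hw
  simp [List.count_replicate, hl.symm]

lemma count_of_mem_pow {z : Letter} {t : ℕ} {w : List Letter}
    (hw : w ∈ (plus zero * sym z) ^ t) {l : Letter} (hl : l ≠ zero) :
    w.count l = if z = l then t else 0 := by
  induction t generalizing w with
  | zero =>
    obtain rfl := (Language.mem_one w).mp hw
    simp
  | succ t ih =>
    rw [pow_succ] at hw
    obtain ⟨u, hu, v, ⟨p, hp, q, rfl, rfl⟩, rfl⟩ := Language.mem_mul.mp hw
    rw [List.count_append, ih hu]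
    simp only [List.count_append, count_of_mem_plus_zero hp hl, List.count_singleton]
    split_ifs <;> simp_all

/-- The words of `block x y z` with parameter `m`. -/
lemma exists_of_mem_block {x y z : Letter} {w : List Letter} (hw : w ∈ block x y z) :
    ∃ m, 3 ≤ m ∧ ∃ r, w = x :: (List.replicate (3 * m + 1) zero ++ y :: r) ∧
      ∀ l, l ≠ zero → r.count l = if z = l then m - 2 else 0 := by
  obtain ⟨m, hm, hw⟩ := hw
  obtain ⟨_, ⟨_, ⟨_, ⟨_, rfl, n, hn, rfl⟩, _, rfl, rfl⟩, u, hu, rfl⟩, v, hv, rfl⟩ := hw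
  obtain rfl := mem_sym_pow.mp hn
  refine ⟨m, hm, u ++ v, by simp, fun l hl => ?_⟩
  rw [List.count_append, count_of_mem_pow hu hl, count_of_mem_plus_zero hv hl, add_zero]

/-- Here m = t + 2. The trailing zeros will be those that precede the next letter d, g or j of the
spread word. -/
lemma spread_mem_block (x y z : Letter) {t : ℕ} (ht : 1 ≤ t) {k : ℕ} (hk : 1 ≤ k) :
    x :: (spread (3 * (t + 2) + 1) (y :: List.replicate t z) ++ List.replicate k zero) ∈
      block x y z := by
  have hpow : ∀ s n : ℕ, 1 ≤ n →
      spread n (List.replicate s z) ∈ (plus zero * sym z) ^ s := by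
    intro s n hn
    induction s with
    | zero => exact Language.nil_mem_one
    | succ s ih =>
      rw [List.replicate_succ, spread_cons, pow_succ']
      exact Language.append_mem_mul (Language.append_mem_mul ⟨n, hn, rfl⟩ rfl) ih
  refine ⟨t + 2, by omega, ?_⟩
  rw [spread_cons]
  have h := Language.append_mem_mul (Language.append_mem_mul (Language.append_mem_mul
    (Language.append_mem_mul (show [x] ∈ sym x from rfl)
      (mem_sym_pow (x := zero) (k := 3 * (t + 2) + 1).mpr rfl))
    (show [y] ∈ sym y from rfl)) (hpow t (3 * (t + 2) + 1) (by omega)))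
    (show List.replicate k zero ∈ plus zero from ⟨k, hk, rfl⟩)
  simpa using h

/-- The word `a b c^r d e f^s g h i^q j`. -/
def patternWord (r s q : ℕ) : List Letter :=
  [a, b] ++ List.replicate r c ++ [d, e] ++ List.replicate s f ++ [g, h] ++
    List.replicate q i ++ [j]

lemma mem_pattern_iff {w : List Letter} :
    w ∈ pattern ↔ ∃ r s q, 1 ≤ r ∧ 1 ≤ s ∧ 1 ≤ q ∧ w = patternWord r s q := by
  constructor
  · rintro ⟨_, ⟨_, ⟨_, ⟨_, ⟨_, ⟨_, ⟨_, ⟨_, ⟨_, rfl, _, rfl, rfl⟩, _, ⟨r, hr, rfl⟩, rfl⟩, _, rfl,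
      rfl⟩, _, rfl, rfl⟩, _, ⟨s, hs, rfl⟩, rfl⟩, _, rfl, rfl⟩, _, rfl, rfl⟩, _, ⟨q, hq, rfl⟩, rfl⟩,
      _, rfl, rfl⟩
    exact ⟨r, s, q, hr, hs, hq, by simp [patternWord]⟩
  · rintro ⟨r, s, q, hr, hs, hq, rfl⟩
    refine ⟨_, ⟨_, ⟨_, ⟨_, ⟨_, ⟨_, ⟨_, ⟨_, ⟨_, rfl, _, rfl, rfl⟩, _, ⟨r, hr, rfl⟩, rfl⟩, _, rfl,
      rfl⟩, _, rfl, rfl⟩, _, ⟨s, hs, rfl⟩, rfl⟩, _, rfl, rfl⟩, _, rfl, rfl⟩, _, ⟨q, hq, rfl⟩, rfl⟩,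
      _, rfl, ?_⟩
    simp [patternWord]

/-- The letters that occur once in the words of `L₁ * L₂ * L₃`. -/
def IsMarker : Letter → Prop
  | c | f | i | zero => False
  | _ => True

/-- The words of `L₁ * L₂ * L₃`. -/
lemma exists_of_mem_mul {w : List Letter} (hw : w ∈ L₁ * L₂ * L₃) :
    ∃ m n p, 3 ≤ m ∧ 3 ≤ n ∧ 3 ≤ p ∧ ∃ r s q,
      w = a :: (List.replicate (3 * m + 1) zero ++ b :: r) ++
        d :: (List.replicate (3 * n + 1) zero ++ e :: s) ++
        g :: (List.replicate (3 * p + 1) zero ++ h :: q) ++ [j] ∧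
      w.count c = m - 2 ∧ w.count f = n - 2 ∧ w.count i = p - 2 ∧
      ∀ l, IsMarker l → w.count l ≤ 1 := by
  rw [L₃_eq] at hw
  obtain ⟨_, ⟨u, hu, v, hv, rfl⟩, _, ⟨x, hx, _, rfl, rfl⟩, rfl⟩ := hw
  obtain ⟨m, hm, r, rfl, hr⟩ := exists_of_mem_block (x := a) (y := b) (z := c) hu
  obtain ⟨n, hn, s, rfl, hs⟩ := exists_of_mem_block (x := d) (y := e) (z := f) hv
  obtain ⟨p, hp, q, rfl, hq⟩ := exists_of_mem_block hx
  refine ⟨m, n, p, hm, hn, hp, r, s, q, by simp, ?_, ?_, ?_, fun l hl => ?_⟩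
  · simp [List.count_replicate, hr, hs, hq]
  · simp [List.count_replicate, hr, hs, hq]
  · simp [List.count_replicate, hr, hs, hq]
  · cases l <;> first
      | exact hl.elim
      | simp [List.count_replicate, hr, hs, hq]

lemma count_le_one_of_mem_diag {x : List Letter} (hx : x ∈ diag (L₁ * L₂ * L₃)) {l : Letter}
    (hl : IsMarker l) : x.count l ≤ 1 := by
  obtain ⟨w, hw, n, -, hlen, rfl⟩ := hx
  obtain ⟨-, -, -, -, -, -, -, -, -, -, -, -, -, h⟩ := exists_of_mem_mul hw
  exact ((diagWord_sublist n w hlen).count_le l).trans (h l hl)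

lemma count_patternWord (r s q : ℕ) (l : Letter) :
    (patternWord r s q).count l =
      match l with
      | c => r
      | f => s
      | i => q
      | zero => 0
      | _ => 1 := by
  cases l <;> simp [patternWord, List.count_replicate]

lemma patternWord_mem_target {t : ℕ} (ht : 1 ≤ t) : patternWord t t t ∈ target := ⟨t, ht, rfl⟩

lemma diag_inf_pattern_le : diag (L₁ * L₂ * L₃) ⊓ pattern ≤ target := by
  rintro x ⟨⟨w, hw, N, -, hlen, rfl⟩, hx⟩
  obtain ⟨r, s, q, hr, hs, hq, hD⟩ := mem_pattern_iff.mp hx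
  obtain ⟨m, n, p, hm, hn, hp, u, v, x, h, hc, hf, hi, hmark⟩ := exists_of_mem_mul hw
  have hN := length_diagWord N w hlen
  have hsub := diagWord_sublist N w hlen
  have h₁ := hsub.count_le c
  have h₂ := hsub.count_le f
  have h₃ := hsub.count_le i
  rw [hD, count_patternWord] at h₁ h₂ h₃
  simp only at h₁ h₂ h₃
  -- The three neighbouring pairs ab, de, gh each determine the side N, forcing m = n = p.
  have e₁ := eq_of_diagWord_neighbours hlen (x := a) (y := b) (hmark _ trivial) (hmark _ trivial)
    (P := []) (by rw [h]; simp only [List.nil_append, List.cons_append, List.append_assoc]; rfl)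
    (D := []) (hD.trans (by
      simp only [patternWord, List.nil_append, List.cons_append, List.append_assoc]; rfl))
  have e₂ := eq_of_diagWord_neighbours hlen (x := d) (y := e) (hmark _ trivial) (hmark _ trivial)
    (P := a :: (List.replicate (3 * m + 1) zero ++ b :: u))
    (Q := List.replicate (3 * n + 1) zero)
    (by rw [h]; simp only [List.cons_append, List.append_assoc]; rfl)
    (D := [a, b] ++ List.replicate r c) (hD.trans (by
      simp only [patternWord, List.nil_append, List.cons_append, List.append_assoc]; rfl))
  have e₃ := eq_of_diagWord_neighbours hlen (x := g) (y := .h) (hmark _ trivial)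
    (hmark _ trivial) (P := a :: (List.replicate (3 * m + 1) zero ++ b :: u) ++
      d :: (List.replicate (3 * n + 1) zero ++ e :: v))
    (Q := List.replicate (3 * p + 1) zero)
    (by rw [h]; simp only [List.cons_append, List.append_assoc]; rfl)
    (D := [a, b] ++ List.replicate r c ++ [d, e] ++ List.replicate s f) (hD.trans (by
      simp only [patternWord, List.nil_append, List.cons_append, List.append_assoc]; rfl))
  rw [List.length_replicate] at e₁ e₂ e₃
  rw [hD] at hN ⊢
  simp only [patternWord, List.length_append, List.length_replicate, List.length_cons,
    List.length_nil] at hN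
  -- r, s, q are at most m - 2, while r + s + q + 7 = 3m + 1; hence each equals m - 2.
  obtain rfl : r = s := by omega
  obtain rfl : r = q := by omega
  exact patternWord_mem_target hr

lemma target_le_pattern : target ≤ pattern := by
  rintro _ ⟨t, ht, rfl⟩
  exact mem_pattern_iff.mpr ⟨t, t, t, ht, ht, ht, rfl⟩

lemma target_le_diag : target ≤ diag (L₁ * L₂ * L₃) := by
  rintro _ ⟨t, ht, rfl⟩
  -- This is both 3m + 1 for m = t + 2 and the length 3t + 7 of the required diagonal.
  let N := 3 * (t + 2) + 1
  have hN : 1 ≤ N := by omega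
  have hlen : (b :: List.replicate t c ++ [d] ++ e :: List.replicate t f ++ [g] ++
      h :: List.replicate t i ++ [j]).length + 1 = N := by
    simp +arith [N]
  refine ⟨_, ?_, N, hN, length_cons_spread a hlen, ?_⟩
  · have h₁ : _ ∈ L₁ := spread_mem_block a b c ht hN
    have h₂ : _ ∈ L₂ := spread_mem_block d e f ht hN
    have h₃ := Language.append_mem_mul (spread_mem_block g h i ht hN) (show [j] ∈ sym j from rfl)
    rw [← L₃_eq] at h₃
    have := Language.append_mem_mul (Language.append_mem_mul h₁ h₂) h₃
    convert this using 1
    simp [N, spread]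
  · rw [diagWord_cons_spread a hlen]
    simp

lemma diag_inf_pattern : diag (L₁ * L₂ * L₃) ⊓ pattern = target :=
  le_antisymm diag_inf_pattern_le (le_inf target_le_diag target_le_pattern)

/-! ### The languages that are not context-free -/

/-- The place of a letter in the alphabetical order. -/
def rank : Letter → ℕ
  | a => 0 | b => 1 | c => 2 | d => 3 | e => 4 | f => 5 | g => 6 | h => 7 | i => 8 | j => 9
  | zero => 10

lemma rank_injective : Function.Injective rank := by
  intro x y h
  cases x <;> cases y <;> first | rfl | simp [rank] at h

/-- The letters of the word are in alphabetical order. -/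
def Sorted (w : List Letter) : Prop := w.Pairwise fun x y => rank x ≤ rank y

lemma sorted_patternWord (r s q : ℕ) : Sorted (patternWord r s q) := by
  simp +contextual [Sorted, patternWord, List.pairwise_append, or_imp, rank]

/-- A sorted word is determined by its letter counts, so fitting `pattern` becomes a matter of
counting. -/
lemma Sorted.eq_patternWord {w : List Letter} (hw : Sorted w) (hzero : w.count zero = 0)
    (hmark : ∀ l, IsMarker l → w.count l = 1) :
    w = patternWord (w.count c) (w.count f) (w.count i) := by
  refine List.Perm.eq_of_pairwise (le := fun x y => rank x ≤ rank y)
    (fun x y _ _ h₁ h₂ => rank_injective (le_antisymm h₁ h₂)) hw (sorted_patternWord _ _ _) ?_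
  rw [List.perm_iff_count]
  intro l
  rw [count_patternWord]
  cases l <;> first | exact hmark _ trivial | exact hzero | rfl

/-- A factor of a sorted word without letters of a marker is on one side of the marker. -/
lemma Sorted.rank_lt_or_lt {u v w : List Letter} (hs : Sorted (u ++ v ++ w)) {l : Letter}
    (hl : l ∈ u ++ v ++ w) (hv : l ∉ v) :
    (∀ x ∈ v, rank l ≤ rank x) ∨ ∀ x ∈ v, rank x ≤ rank l := by
  simp only [Sorted, List.pairwise_append, List.mem_append] at hs hl
  rcases hl with (hl | hl) | hl
  · exact .inl fun x hx => hs.1.2.2 l hl x hx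
  · exact (hv hl).elim
  · exact .inr fun x hx => hs.2.2 x (.inr hx) l hl

/-- If a sorted word contains all markers, then any two letters of a factor without markers
and zeros are equal. -/
lemma Sorted.eq_of_mem {u v w : List Letter} (hs : Sorted (u ++ v ++ w))
    (hzero : zero ∉ v) (hmem : ∀ l, IsMarker l → l ∈ u ++ v ++ w)
    (hv : ∀ l, IsMarker l → l ∉ v) {x y : Letter} (hx : x ∈ v) (hy : y ∈ v) : x = y := by
  -- Only c, f, i remain possible; d separates c from f, and g separates f from i.
  have hd := hs.rank_lt_or_lt (hmem d trivial) (hv d trivial)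
  have hg := hs.rank_lt_or_lt (hmem g trivial) (hv g trivial)
  have hx' : ¬ IsMarker x := fun h => hv x h hx
  have hy' : ¬ IsMarker y := fun h => hv y h hy
  have hx₀ : x ≠ zero := fun h => hzero (h ▸ hx)
  have hy₀ : y ≠ zero := fun h => hzero (h ▸ hy)
  have hxd := hd.imp (fun h => And.intro (h x hx) (h y hy)) fun h => And.intro (h x hx) (h y hy)
  have hxg := hg.imp (fun h => And.intro (h x hx) (h y hy)) fun h => And.intro (h x hx) (h y hy)
  cases x <;> first
    | exact (hx' trivial).elim
    | exact (hx₀ rfl).elim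
    | cases y <;> first
      | rfl
      | exact (hy' trivial).elim
      | exact (hy₀ rfl).elim
      | simp [rank] at hxd hxg

lemma Sorted.double {u v x y z : List Letter} (hs : Sorted (u ++ v ++ x ++ y ++ z))
    (hv : ∀ k ∈ v, ∀ l ∈ v, k = l) (hy : ∀ k ∈ y, ∀ l ∈ y, k = l) :
    Sorted (u ++ v ++ v ++ x ++ y ++ y ++ z) := by
  have hv' : ∀ k ∈ v, ∀ l ∈ v, rank k ≤ rank l := fun k hk l hl => (hv k hk l hl ▸ le_rfl)
  have hy' : ∀ k ∈ y, ∀ l ∈ y, rank k ≤ rank l := fun k hk l hl => (hy k hk l hl ▸ le_rfl)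
  simp only [Sorted, List.pairwise_append, List.mem_append] at hs ⊢
  grind

/-- A language between `target` and the words with at most one occurrence of each marker is not
context-free if its words of the form `pattern` are in `target`. -/
theorem not_isContextFree_of_target_le {L : Language Letter} (h₁ : target ≤ L)
    (h₂ : ∀ w ∈ L, ∀ l, IsMarker l → w.count l ≤ 1) (h₃ : L ⊓ pattern ≤ target) :
    ¬ L.IsContextFree := by
  intro hL
  obtain ⟨p, hp⟩ := hL.exists_pump
  obtain ⟨u, v, x, y, z, hw, hne, hmem⟩ := hp (patternWord (p + 1) (p + 1) (p + 1))
    (h₁ (patternWord_mem_target (by omega))) (by simp [patternWord]; omega)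
  have hs := hw ▸ sorted_patternWord (p + 1) (p + 1) (p + 1)
  have hcount := count_patternWord (p + 1) (p + 1) (p + 1)
  simp only [hw, List.count_append] at hcount
  -- The original word has each marker exactly once and the doubled one at most once, so no marker
  -- lies in `v` or `y`.
  have hmark : ∀ l, IsMarker l → v.count l = 0 ∧ y.count l = 0 ∧
      u.count l + v.count l + x.count l + y.count l + z.count l = 1 := by
    intro l hl
    have h := h₂ _ hmem l hl
    have h' := hcount l
    simp only [List.count_append] at h
    cases l <;> first | exact hl.elim | (simp only at h'; omega)
  have hzero : _ = 0 := hcount zero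
  have hin : ∀ l, IsMarker l → l ∈ u ++ v ++ x ++ y ++ z := fun l hl =>
    List.count_pos_iff.mp (by simp only [List.count_append]; have := hmark l hl; omega)
  have hv : ∀ k ∈ v, ∀ l ∈ v, k = l := fun k hk l hl => by
    refine Sorted.eq_of_mem (u := u) (v := v) (w := x ++ y ++ z) (by simpa using hs)
      (List.count_eq_zero.mp (by omega)) (by simpa using hin)
      (fun l hl => List.count_eq_zero.mp (hmark l hl).1) hk hl
  have hy : ∀ k ∈ y, ∀ l ∈ y, k = l := fun k hk l hl => by
    refine Sorted.eq_of_mem (u := u ++ v ++ x) (v := y) (w := z) hs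
      (List.count_eq_zero.mp (by omega)) hin
      (fun l hl => List.count_eq_zero.mp (hmark l hl).2.1) hk hl
  have hpat := (hs.double hv hy).eq_patternWord
    (by simp only [List.count_append]; omega)
    (fun l hl => by simp only [List.count_append]; have := hmark l hl; omega)
  have hc := hcount c
  have hf := hcount f
  have hi := hcount i
  simp only at hc hf hi
  have htarget := h₃ ⟨hmem, mem_pattern_iff.mpr ⟨_, _, _, by simp only [List.count_append]; omega,
    by simp only [List.count_append]; omega, by simp only [List.count_append]; omega, hpat⟩⟩
  obtain ⟨t, -, ht⟩ := htarget
  have ht' := fun l => (congrArg (List.count l) ht).trans (count_patternWord t t t l)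
  have hc' := ht' c
  have hf' := ht' f
  have hi' := ht' i
  simp only [List.count_append] at hc' hf' hi'
  -- `v` and `y` each contain at most one of c, f, i, so some count stays p + 1. Membership in
  -- `target` makes all three equal, so none grows and `v ++ y` is empty.
  have hexcl : ∀ s : List Letter, (∀ k ∈ s, ∀ l ∈ s, k = l) → ∀ k l, k ≠ l →
      s.count k = 0 ∨ s.count l = 0 := by
    intro s hs k l hkl
    by_contra! hcon
    exact hkl (hs k (List.count_pos_iff.mp (by omega)) l (List.count_pos_iff.mp (by omega)))
  have hv_cf := hexcl v hv c f (by decide)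
  have hv_ci := hexcl v hv c i (by decide)
  have hv_fi := hexcl v hv f i (by decide)
  have hy_cf := hexcl y hy c f (by decide)
  have hy_ci := hexcl y hy c i (by decide)
  have hy_fi := hexcl y hy f i (by decide)
  refine hne (List.eq_nil_iff_forall_not_mem.mpr fun l => ?_)
  rw [← List.count_eq_zero, List.count_append]
  by_cases hl : IsMarker l
  · have := hmark l hl
    omega
  · cases l <;> first
      | exact (hl trivial).elim
      | omega

lemma not_isContextFree_diag : ¬ (diag (L₁ * L₂ * L₃)).IsContextFree :=
  not_isContextFree_of_target_le target_le_diag (fun _ hw _ hl => count_le_one_of_mem_diag hw hl)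
    diag_inf_pattern_le

lemma not_isContextFree_target : ¬ target.IsContextFree :=
  not_isContextFree_of_target_le le_rfl
    (fun _ hw _ hl => count_le_one_of_mem_diag (target_le_diag hw) hl) inf_le_left

end DiagLang

theorem theorem5 :
    DiagLang.L₁.IsContextFree ∧ DiagLang.L₂.IsContextFree ∧ DiagLang.L₃.IsContextFree ∧
    ∃ L : Language DiagLang.Letter,
      L = DiagLang.L₁ * DiagLang.L₂ * DiagLang.L₃ ∧
      L.IsContextFree ∧
      ¬ (DiagLang.diag L).IsContextFree ∧
      DiagLang.diag L ⊓ DiagLang.pattern = DiagLang.target ∧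
      ¬ DiagLang.target.IsContextFree :=
  ⟨DiagLang.isContextFree_L₁, DiagLang.isContextFree_L₂, DiagLang.isContextFree_L₃, _, rfl,
    (DiagLang.isContextFree_L₁.mul DiagLang.isContextFree_L₂).mul DiagLang.isContextFree_L₃,
    DiagLang.not_isContextFree_diag, DiagLang.diag_inf_pattern, DiagLang.not_isContextFree_target⟩
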